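/- Let $n>1$ be an integer and $1\le p\le\infty$. Let $B_p^n=\{z\in\mathbb{C}^n:\|z\|_{\ell_p^n}<1\}$ be the unit ball of complex $\ell_p^n$, where $\|z\|_{\ell_p^n}=\bigl(\sum_{j=1}^n|z_j|^p\bigr)^{1/p}$ for $p<\infty$ and $\|z\|_{\ell_\infty^n}=\max_j|z_j|$. For $G=B_p^n$, the second (Aizenberg) Bohr radius $B(G)$ is the largest $r\ge0$ such that, for every power series $\sum_\alpha c_\alpha z^\alpha$ (with complex coefficients, $\alpha$ ranging over $n$-tuples of non-negative integers) that converges on $G$ and satisfies $\bigl|\sum_\alpha c_\alpha z^\alpha\bigr|\le1$ for all $z\in G$, one has $\sum_\alpha\sup_{z\in rG}|c_\alpha z^\alpha|\le1$. This largest $r$ exists, and it admits the following bounds. - If $1\le p\le2$, then $$\frac13\cdot\frac1n<1-\left(\frac23\right)^{1/n}\le B(B_p^n)<4\cdot\frac{\log n}{n}.$$ - If $2\le p\le\infty$, then $$\frac13\left(\frac1n\right)^{\frac12+\frac1p}\le B(B_p^n)<4\left(\frac{\log n}{n}\right)^{\frac12+\frac1p},$$ where $1/p$ is read as $0$ for $p=\infty$.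 -/

import Mathlib

open scoped ENNReal Pointwise

noncomputable section

/-- The unit ball `B_p^n` of complex `ℓ_p^n`, as a subset of `ℂⁿ`; for `p = ∞` it is the
open unit polydisc. -/
def lpUnitBall (n : ℕ) (p : ℝ≥0∞) : Set (Fin n → ℂ) :=
  {z | ‖(WithLp.toLp p z : PiLp p (fun _ : Fin n => ℂ))‖ < 1}

/-- The term `c_α z^α` of the power series with coefficients `c`, where
`z^α = z_1^{α_1} ⋯ z_n^{α_n}`. -/
def powerTerm {n : ℕ} (c : (Fin n → ℕ) → ℂ) (z : Fin n → ℂ) (α : Fin n → ℕ) : ℂ :=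
  c α * ∏ i, z i ^ α i

/-- The power series `∑_α c_α z^α` converges at every point of `G` and its sum has modulus at
most `1` there. -/
def BoundedByOneOn {n : ℕ} (c : (Fin n → ℕ) → ℂ) (G : Set (Fin n → ℂ)) : Prop :=
  ∀ z ∈ G, Summable (powerTerm c z) ∧ ‖∑' α, powerTerm c z α‖ ≤ 1

/-- The `r ≥ 0` such that every power series bounded by one on `G` satisfies
`∑_α sup_{z ∈ rG} |c_α z^α| ≤ 1`. Sums and suprema are taken in `[0, ∞]`. -/
def secondBohrSet {n : ℕ} (G : Set (Fin n → ℂ)) : Set ℝ :=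
  {r | 0 ≤ r ∧ ∀ c : (Fin n → ℕ) → ℂ, BoundedByOneOn c G →
    ∑' α : Fin n → ℕ, ⨆ z ∈ r • G, ‖powerTerm c z α‖ₑ ≤ 1}

/-- The second Bohr radius `B(G)`: the largest element of `secondBohrSet G`. -/
def secondBohrRadius {n : ℕ} (G : Set (Fin n → ℂ)) : ℝ :=
  sSup (secondBohrSet G)

end

/-! ### Averages over roots of unity -/

/-! Lower bounds. If a series is bounded by one, averaging it over roots of unity against a
nonnegative kernel shows that each homogeneous part of positive degree is at most `2 * (1 - ‖c 0‖)`.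
Parseval on the torus turns this into an ℓ² bound for the monomials of each degree
(`BoundedByOneOn.sum_norm_sq_homogeneous_le`). Applied to single monomials and summed over all
multi-indices, it gives `1 - (2/3)^(1/n)`. Applied on the polydisc of radius `n^(-1/p)` inside the
ball, with Cauchy–Schwarz over the at most `n^k` monomials of degree `k`, it gives `n^(-1/p) /
(3√n)`. In both cases the weights of positive degree sum to at most `1/2`, so the total is at most
`‖c 0‖ + (1 - ‖c 0‖) = 1`.

Upper bounds. Split `d * m ≤ n` variables into `d` blocks of size `m` and take a `d`-linear form
with unimodular coefficients. It has `m^d` squarefree monomials of equal size, while its norm on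
products of Euclidean balls can be as small as `d * m` (`exists_unimodular_norm_le`, by a moment
argument over random roots of unity). Comparing ℓ² with ℓ^p on the blocks yields `(m^(1-h) * r)^d ≤
d * m`, where `1 - h` is the exponent in the theorem (`pow_le_of_mem_secondBohrSet`). With `d = ⌈log
n⌉` the `d`-th root of `d * m` is bounded and `m` is of order `n / log n`.

The supremum is attained because finite partial sums cut out a closed set of radii. -/

theorem sum_stdAddChar_pow_mul_conj_pow (M : ℕ) [NeZero M] {a b : ℕ} (ha : a < M) (hb : b < M) :
    ∑ u : ZMod M, ZMod.stdAddChar u ^ a * (starRingEnd ℂ) (ZMod.stdAddChar u) ^ b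
      = if a = b then (M : ℂ) else 0 := by
  have h : ∀ u : ZMod M,
      ZMod.stdAddChar u ^ a * (starRingEnd ℂ) (ZMod.stdAddChar u : ℂ) ^ b
        = (ZMod.stdAddChar (u * ((a : ZMod M) - (b : ZMod M))) : ℂ) := by
    intro u
    rw [← AddChar.map_neg_eq_conj, ← AddChar.map_nsmul_eq_pow, ← AddChar.map_nsmul_eq_pow,
      ← AddChar.map_add_eq_mul]
    congr 1
    simp only [nsmul_eq_mul]
    ring
  rw [Finset.sum_congr rfl fun u _ => h u,
    AddChar.sum_mulShift _ (ZMod.isPrimitive_stdAddChar M), ZMod.card]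
  have : ((a : ZMod M) - (b : ZMod M) = 0) ↔ a = b := by
    rw [sub_eq_zero, ZMod.natCast_eq_natCast_iff']
    rw [Nat.mod_eq_of_lt ha, Nat.mod_eq_of_lt hb]
  simp only [this]
  split_ifs <;> simp

/-- Parseval's identity for a polynomial sampled on a grid of roots of unity. -/
theorem sum_norm_sq_sum_mul_prod_stdAddChar {ι : Type*} [Fintype ι] [DecidableEq ι] (M : ℕ)
    [NeZero M] (S : Finset (ι → ℕ)) (hS : ∀ e ∈ S, ∀ i, e i < M) (a : (ι → ℕ) → ℂ) :
    ∑ w : ι → ZMod M, ‖∑ e ∈ S, a e * ∏ i, (ZMod.stdAddChar (w i) : ℂ) ^ e i‖ ^ 2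
      = (M : ℝ) ^ Fintype.card ι * ∑ e ∈ S, ‖a e‖ ^ 2 := by
  have key : ∀ e ∈ S, ∀ f ∈ S,
      ∑ w : ι → ZMod M, (∏ i, (ZMod.stdAddChar (w i) : ℂ) ^ e i) *
        (starRingEnd ℂ) (∏ i, (ZMod.stdAddChar (w i) : ℂ) ^ f i)
      = if e = f then (M : ℂ) ^ Fintype.card ι else 0 := by
    intro e he f hf
    simp only [map_prod, map_pow, ← Finset.prod_mul_distrib]
    rw [← Fintype.prod_sum (fun i (u : ZMod M) =>
      (ZMod.stdAddChar u : ℂ) ^ e i * (starRingEnd ℂ) (ZMod.stdAddChar u) ^ f i)]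
    rw [Finset.prod_congr rfl fun i _ =>
      sum_stdAddChar_pow_mul_conj_pow M (hS e he i) (hS f hf i)]
    split_ifs with h
    · subst h; simp
    · obtain ⟨i, hi⟩ := Function.ne_iff.1 h
      exact Finset.prod_eq_zero (Finset.mem_univ i) (by simp [hi])
  have h2 : ((∑ w : ι → ZMod M,
      ‖∑ e ∈ S, a e * ∏ i, (ZMod.stdAddChar (w i) : ℂ) ^ e i‖ ^ 2 : ℝ) : ℂ)
      = (((M : ℝ) ^ Fintype.card ι * ∑ e ∈ S, ‖a e‖ ^ 2 : ℝ) : ℂ) := by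
    push_cast
    simp only [← Complex.mul_conj', map_sum, Finset.sum_mul_sum]
    rw [Finset.sum_comm, Finset.mul_sum]
    refine Finset.sum_congr rfl fun e he => ?_
    rw [Finset.sum_comm]
    have : ∀ f ∈ S, ∑ w : ι → ZMod M, a e * (∏ i, (ZMod.stdAddChar (w i) : ℂ) ^ e i) *
        (starRingEnd ℂ) (a f * ∏ i, (ZMod.stdAddChar (w i) : ℂ) ^ f i)
        = a e * (starRingEnd ℂ) (a f) * if e = f then (M : ℂ) ^ Fintype.card ι else 0 := by
      intro f hf
      rw [← key e he f hf, Finset.mul_sum]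
      refine Finset.sum_congr rfl fun w _ => ?_
      rw [map_mul]; ring
    rw [Finset.sum_congr rfl this]
    simp [he]
    ring
  exact_mod_cast h2

theorem exists_norm_add_mul_eq (x y : ℂ) : ∃ v : ℂ, ‖v‖ = 1 ∧ ‖x + v * y‖ = ‖x‖ + ‖y‖ := by
  refine ⟨Complex.exp ((x.arg - y.arg : ℝ) * Complex.I), Complex.norm_exp_ofReal_mul_I _, ?_⟩
  have h : x + Complex.exp ((x.arg - y.arg : ℝ) * Complex.I) * y
      = ((‖x‖ + ‖y‖ : ℝ) : ℂ) * Complex.exp (x.arg * Complex.I) := by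
    conv_lhs => rw [← Complex.norm_mul_exp_arg_mul_I x]
    conv_lhs => enter [2, 2]; rw [← Complex.norm_mul_exp_arg_mul_I y]
    push_cast
    rw [sub_mul, Complex.exp_sub, add_mul, Complex.norm_mul_exp_arg_mul_I]
    have := Complex.exp_ne_zero (y.arg * Complex.I)
    field_simp
  rw [h, norm_mul, Complex.norm_exp_ofReal_mul_I, mul_one, Complex.norm_of_nonneg (by positivity)]

/-- A coefficient inequality for polynomials bounded on the unit circle. -/
theorem two_mul_norm_coeff_zero_add_norm_coeff_le {κ : Type*} (S : Finset κ) (deg : κ → ℕ)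
    (a : κ → ℂ) (C : ℝ) (hC : ∀ ζ : ℂ, ‖ζ‖ = 1 → ‖∑ s ∈ S, a s * ζ ^ deg s‖ ≤ C)
    {k : ℕ} (hk : 0 < k) :
    2 * ‖∑ s ∈ S with deg s = 0, a s‖ + ‖∑ s ∈ S with deg s = k, a s‖ ≤ 2 * C := by
  classical
  set b0 := ∑ s ∈ S with deg s = 0, a s with hb0
  set bk := ∑ s ∈ S with deg s = k, a s with hbk
  -- `M` exceeds every `deg s + k`, so no two frequencies that occur below coincide modulo `M`.
  obtain ⟨M, hM⟩ : ∃ M : ℕ, k < M ∧ ∀ s ∈ S, deg s + k < M :=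
    ⟨S.sup deg + k + 1, by omega, fun s hs => by
      have := Finset.le_sup (f := deg) hs; omega⟩
  obtain ⟨hkM, hM⟩ := hM
  have : NeZero M := ⟨by omega⟩
  have hM0 : (0 : ℝ) < M := by exact_mod_cast (by omega : 0 < M)
  obtain ⟨v, hv, hv2⟩ := exists_norm_add_mul_eq (2 * b0) bk
  have hvv : v * (starRingEnd ℂ) v = 1 := by rw [Complex.mul_conj', hv]; simp
  let χ : ZMod M → ℂ := fun u => ZMod.stdAddChar u
  -- The kernel is a squared modulus, hence nonnegative with mean 2. Its only frequencies are 0 and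
  -- `±k`, so averaging against it isolates `2 * b0 + v * bk`; `v` was chosen to align the two
  -- phases.
  let K : ZMod M → ℂ := fun u =>
    (1 + (starRingEnd ℂ) v * χ u ^ k) * (starRingEnd ℂ) (1 + (starRingEnd ℂ) v * χ u ^ k)
  have hχ : ∀ u, ‖χ u‖ = 1 := fun u => AddChar.norm_apply _ _
  have orth : ∀ a b : ℕ, a < M → b < M →
      ∑ u, χ u ^ a * (starRingEnd ℂ) (χ u) ^ b = if a = b then (M : ℂ) else 0 :=
    fun a b ha hb => sum_stdAddChar_pow_mul_conj_pow M ha hb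
  have hKsum : ∀ n : ℕ, n + k < M → ∑ u, χ u ^ n * K u
      = (if n = 0 then 2 * (M : ℂ) else 0) + if n = k then v * M else 0 := by
    intro n hn
    have h1 := orth n 0 (by omega) (by omega)
    have h2 := orth n k (by omega) (by omega)
    have h3 := orth (n + k) 0 (by omega) (by omega)
    have h4 := orth (n + k) k (by omega) (by omega)
    have : ∑ u, χ u ^ n * K u
        = ∑ u, χ u ^ n * (starRingEnd ℂ) (χ u) ^ 0
          + v * ∑ u, χ u ^ n * (starRingEnd ℂ) (χ u) ^ k
          + (starRingEnd ℂ) v * ∑ u, χ u ^ (n + k) * (starRingEnd ℂ) (χ u) ^ 0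
          + ∑ u, χ u ^ (n + k) * (starRingEnd ℂ) (χ u) ^ k := by
      simp only [Finset.mul_sum, ← Finset.sum_add_distrib]
      refine Finset.sum_congr rfl fun u _ => ?_
      simp only [K, map_add, map_mul, map_one, map_pow, Complex.conj_conj]
      linear_combination χ u ^ (n + k) * (starRingEnd ℂ) (χ u) ^ k * hvv
    rw [this, h1, h2, h3, h4]
    have e3 : (n + k = 0) = False := by simp; omega
    have e4 : (n + k = k) = (n = 0) := by simp
    simp only [e3, e4, if_false]
    split_ifs <;> ring
  have hKnorm : ∀ u, ((‖K u‖ : ℝ) : ℂ) = K u := by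
    intro u
    simp only [K, Complex.mul_conj', norm_pow, Complex.norm_real, norm_norm]
    push_cast; rfl
  have hKtot : ∑ u, ‖K u‖ = 2 * M := by
    have h := hKsum 0 (by omega)
    have hk' : (0 = k) = False := by simp; omega
    simp only [pow_zero, one_mul, if_true, hk', if_false, add_zero] at h
    have : ((∑ u, ‖K u‖ : ℝ) : ℂ) = ((2 * M : ℝ) : ℂ) := by
      push_cast
      rw [← h]
      exact Finset.sum_congr rfl fun u _ => hKnorm u
    exact_mod_cast this
  have hmain : ∑ u, (∑ s ∈ S, a s * χ u ^ deg s) * K u = M * (2 * b0 + v * bk) := by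
    simp only [Finset.sum_mul]
    rw [Finset.sum_comm]
    have : ∀ s ∈ S, ∑ u, a s * χ u ^ deg s * K u
        = 2 * M * (if deg s = 0 then a s else 0) + v * M * (if deg s = k then a s else 0) := by
      intro s hs
      simp only [mul_assoc]
      rw [← Finset.mul_sum, hKsum _ (hM s hs)]
      split_ifs <;> ring
    rw [Finset.sum_congr rfl this, Finset.sum_add_distrib, ← Finset.mul_sum, ← Finset.mul_sum,
      ← Finset.sum_filter, ← Finset.sum_filter]
    ring
  have hle : ‖∑ u, (∑ s ∈ S, a s * χ u ^ deg s) * K u‖ ≤ C * (2 * M) := by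
    refine (norm_sum_le _ _).trans ?_
    rw [← hKtot, Finset.mul_sum]
    refine Finset.sum_le_sum fun u _ => ?_
    rw [norm_mul]
    exact mul_le_mul_of_nonneg_right (hC _ (hχ u)) (norm_nonneg _)
  rw [hmain, norm_mul, hv2, norm_mul] at hle
  simp only [Complex.norm_natCast, Complex.norm_ofNat] at hle
  nlinarith

/-! ### Homogeneous parts of bounded power series -/

theorem powerTerm_mul {n : ℕ} (c : (Fin n → ℕ) → ℂ) (w z : Fin n → ℂ) (α : Fin n → ℕ) :
    powerTerm c (w * z) α = powerTerm c z α * ∏ i, w i ^ α i := by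
  simp only [powerTerm, Pi.mul_apply, mul_pow, Finset.prod_mul_distrib]
  ring

theorem powerTerm_smul {n : ℕ} (c : (Fin n → ℕ) → ℂ) (ζ : ℂ) (z : Fin n → ℂ) (α : Fin n → ℕ) :
    powerTerm c (fun i => ζ * z i) α = powerTerm c z α * ζ ^ ∑ i, α i := by
  have := powerTerm_mul c (fun _ => ζ) z α
  rw [Finset.prod_pow_eq_pow_sum] at this
  exact this

theorem powerTerm_zero_index {n : ℕ} (c : (Fin n → ℕ) → ℂ) (z : Fin n → ℂ) :
    powerTerm c z 0 = c 0 := by simp [powerTerm]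

/-- On the circle `ζ ↦ ζ z` the series is a power series in `ζ` whose coefficients are the
homogeneous parts at `z`. A finite truncation containing degrees 0 and `k` in full is bounded by `1
+ δ / 2`, so the polynomial inequality applies, and `δ` is arbitrary. -/
theorem BoundedByOneOn.two_mul_norm_add_norm_homogeneous_le {n : ℕ} {c : (Fin n → ℕ) → ℂ}
    {G : Set (Fin n → ℂ)} (hc : BoundedByOneOn c G) {z : Fin n → ℂ}
    (hz : ∀ ζ : ℂ, ‖ζ‖ = 1 → (fun i => ζ * z i) ∈ G) {k : ℕ} (hk : 0 < k) :
    2 * ‖c 0‖ + ‖∑ α ∈ Finset.piAntidiag Finset.univ k, powerTerm c z α‖ ≤ 2 := by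
  have hs : Summable fun α => ‖powerTerm c z α‖ := by
    have := (hc _ (hz 1 (by simp))).1.norm
    simpa using this
  refine le_of_forall_pos_le_add fun δ hδ => ?_
  obtain ⟨S1, hS1⟩ := (hs.hasSum.eventually (lt_mem_nhds
    (show (∑' α, ‖powerTerm c z α‖) - δ / 2 < ∑' α, ‖powerTerm c z α‖ by linarith))).exists_forall_of_atTop
  set S := S1 ∪ ({0} ∪ Finset.piAntidiag Finset.univ k) with hS
  have hSS := hS1 S (by exact Finset.subset_union_left)
  have hf0 : S.filter (fun α => ∑ i, α i = 0) = {0} := by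
    ext α
    simp only [hS, Finset.mem_filter, Finset.mem_union, Finset.mem_singleton,
      Finset.mem_piAntidiag, Finset.sum_eq_zero_iff, Finset.mem_univ, true_imp_iff]
    constructor
    · rintro ⟨-, h⟩; exact funext h
    · rintro rfl; simp
  have hfk : S.filter (fun α => ∑ i, α i = k) = Finset.piAntidiag Finset.univ k := by
    ext α
    simp only [hS, Finset.mem_filter, Finset.mem_union, Finset.mem_singleton,
      Finset.mem_piAntidiag, Finset.mem_univ]
    constructor
    · rintro ⟨-, h⟩; exact ⟨h, by simp⟩
    · rintro ⟨h, -⟩; exact ⟨Or.inr (Or.inr ⟨h, by simp⟩), h⟩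
  have key := two_mul_norm_coeff_zero_add_norm_coeff_le S (fun α => ∑ i, α i) (powerTerm c z)
    (1 + δ / 2) (fun ζ hζ => ?_) hk
  · rw [hf0, hfk, Finset.sum_singleton, powerTerm_zero_index] at key
    linarith
  · have hb := hc _ (hz ζ hζ)
    rw [show powerTerm c (fun i => ζ * z i) = fun α => powerTerm c z α * ζ ^ ∑ i, α i from
      funext (powerTerm_smul c ζ z)] at hb
    have h1 := hb.1.sum_add_tsum_subtype_compl S
    have h2 := hs.sum_add_tsum_subtype_compl S
    have h3 : ‖∑' α : {α // α ∉ S}, powerTerm c z α * ζ ^ ∑ i, (α : Fin n → ℕ) i‖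
        ≤ ∑' α : {α // α ∉ S}, ‖powerTerm c z α‖ := by
      refine (norm_tsum_le_tsum_norm ?_).trans (le_of_eq ?_)
      · exact (hb.1.norm).subtype _
      · simp [hζ]
    have h4 : ∑ α ∈ S, powerTerm c z α * ζ ^ ∑ i, α i
        = ∑' α, powerTerm c z α * ζ ^ ∑ i, α i
          - ∑' α : {α // α ∉ S}, powerTerm c z α * ζ ^ ∑ i, (α : Fin n → ℕ) i := by
      rw [← h1]; ring
    rw [h4]
    refine (norm_sub_le _ _).trans ?_
    linarith [hb.2]

/-- Parseval's inequality for the homogeneous parts of a bounded power series. -/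
theorem BoundedByOneOn.sum_norm_sq_homogeneous_le {n : ℕ} {c : (Fin n → ℕ) → ℂ}
    {G : Set (Fin n → ℂ)} (hc : BoundedByOneOn c G) {z : Fin n → ℂ}
    (hz : ∀ w : Fin n → ℂ, (∀ i, ‖w i‖ = 1) → w * z ∈ G) {k : ℕ} (hk : 0 < k) :
    ∑ α ∈ Finset.piAntidiag Finset.univ k, ‖powerTerm c z α‖ ^ 2 ≤ (2 * (1 - ‖c 0‖)) ^ 2 := by
  -- Exponents in degree `k` are at most `k`, so a grid of `(k + 1)`-th roots of unity already gives
  -- exact orthogonality.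
  have hk1 : NeZero (k + 1) := ⟨by omega⟩
  have h := sum_norm_sq_sum_mul_prod_stdAddChar (k + 1) (Finset.piAntidiag Finset.univ k)
    (fun e he i => by
      rw [Finset.mem_piAntidiag] at he
      have := Finset.single_le_sum (f := e) (fun _ _ => Nat.zero_le _) (Finset.mem_univ i)
      have : ∑ i, e i = k := he.1
      omega) (powerTerm c z)
  have hle : ∀ w : Fin n → ZMod (k + 1),
      ‖∑ e ∈ Finset.piAntidiag Finset.univ k,
        powerTerm c z e * ∏ i, (ZMod.stdAddChar (w i) : ℂ) ^ e i‖ ^ 2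
        ≤ (2 * (1 - ‖c 0‖)) ^ 2 := by
    intro w
    have h1 := hc.two_mul_norm_add_norm_homogeneous_le
      (z := (fun i => (ZMod.stdAddChar (w i) : ℂ)) * z) (fun ζ hζ => by
        have := hz (fun i => ζ * ZMod.stdAddChar (w i)) (fun i => by
          rw [norm_mul, hζ, AddChar.norm_apply, one_mul])
        convert this using 1
        ext i; simp [mul_assoc]) hk
    simp only [powerTerm_mul] at h1
    exact pow_le_pow_left₀ (norm_nonneg _) (by linarith) 2
  have h2 := Finset.sum_le_sum fun w (_ : w ∈ Finset.univ) => hle w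
  rw [h, Finset.sum_const, nsmul_eq_mul, Finset.card_univ] at h2
  simp only [Fintype.card_fun, ZMod.card, Fintype.card_fin, Nat.cast_pow] at h2
  exact le_of_mul_le_mul_left h2 (by positivity)

/-! ### The set defining the Bohr radius -/

theorem iSup_smul_enorm_powerTerm {n : ℕ} (G : Set (Fin n → ℂ)) (c : (Fin n → ℕ) → ℂ)
    {r : ℝ} (hr : 0 ≤ r) (α : Fin n → ℕ) :
    ⨆ z ∈ r • G, ‖powerTerm c z α‖ₑ
      = ENNReal.ofReal r ^ (∑ i, α i) * ⨆ z ∈ G, ‖powerTerm c z α‖ₑ := by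
  rw [← Set.image_smul, iSup_image]
  simp only [ENNReal.mul_iSup]
  refine iSup_congr fun z => iSup_congr fun _ => ?_
  have : (r • z) = fun i => (r : ℂ) * z i := by ext i; simp
  rw [this, powerTerm_smul, enorm_mul, enorm_pow, mul_comm]
  congr 2
  rw [← ofReal_norm, Complex.norm_of_nonneg hr]

theorem enorm_powerTerm_le {n : ℕ} (c : (Fin n → ℕ) → ℂ) {z : Fin n → ℂ} (hz : ∀ i, ‖z i‖ ≤ 1)
    (α : Fin n → ℕ) : ‖powerTerm c z α‖ₑ ≤ ‖c α‖ₑ := by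
  rw [← ofReal_norm, ← ofReal_norm]
  refine ENNReal.ofReal_le_ofReal ?_
  rw [powerTerm, norm_mul, norm_prod]
  refine mul_le_of_le_one_right (norm_nonneg _) (Finset.prod_le_one (fun _ _ => norm_nonneg _) ?_)
  intro i _
  rw [norm_pow]
  exact pow_le_one₀ (norm_nonneg _) (hz i)

/-- A sum in `[0, ∞]` is the supremum of its finite partial sums. Each of these is continuous in
`r`, because the suprema over `G` are finite when `G` lies in the closed unit polydisc. -/
theorem isClosed_secondBohrSet {n : ℕ} {G : Set (Fin n → ℂ)} (hG : ∀ z ∈ G, ∀ i, ‖z i‖ ≤ 1) :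
    IsClosed (secondBohrSet G) := by
  have : secondBohrSet G = {r : ℝ | 0 ≤ r} ∩ ⋂ (c : (Fin n → ℕ) → ℂ) (_ : BoundedByOneOn c G)
      (S : Finset (Fin n → ℕ)), {r : ℝ | ∑ α ∈ S,
        (⨆ z ∈ G, ‖powerTerm c z α‖ₑ) * ENNReal.ofReal r ^ (∑ i, α i) ≤ 1} := by
    ext r
    simp only [secondBohrSet, Set.mem_ofPred_eq, Set.mem_inter_iff, Set.mem_iInter]
    refine and_congr_right fun hr => forall_congr' fun c => forall_congr' fun _ => ?_
    simp only [iSup_smul_enorm_powerTerm G c hr, ENNReal.tsum_eq_iSup_sum, iSup_le_iff, mul_comm]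
  rw [this]
  refine isClosed_Ici.inter (isClosed_iInter fun c => isClosed_iInter fun _ =>
    isClosed_iInter fun S => isClosed_le (continuous_finsetSum _ fun α _ => ?_) continuous_const)
  have hfin : (⨆ z ∈ G, ‖powerTerm c z α‖ₑ) ≠ ∞ :=
    ne_top_of_le_ne_top enorm_ne_top
      (iSup₂_le fun z hz => enorm_powerTerm_le c (hG z hz) α)
  exact (ENNReal.continuous_const_mul hfin).comp
    ((ENNReal.continuous_pow _).comp ENNReal.continuous_ofReal)

theorem zero_mem_secondBohrSet {n : ℕ} {G : Set (Fin n → ℂ)} (hG : 0 ∈ G) :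
    0 ∈ secondBohrSet G := by
  refine ⟨le_rfl, fun c hc => ?_⟩
  simp only [iSup_smul_enorm_powerTerm G c le_rfl, ENNReal.ofReal_zero]
  rw [tsum_eq_single 0]
  · simp only [Pi.zero_apply, Finset.sum_const_zero, pow_zero, one_mul]
    refine iSup₂_le fun z hz => ?_
    rw [powerTerm_zero_index]
    have h := (hc 0 hG).2
    rw [tsum_eq_single 0, powerTerm_zero_index] at h
    · rw [← ofReal_norm]; exact ENNReal.ofReal_le_one.2 h
    · intro α hα
      obtain ⟨i, hi⟩ := Function.ne_iff.1 hα
      rw [powerTerm, Finset.prod_eq_zero (Finset.mem_univ i), mul_zero]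
      simpa using hi
  · intro α hα
    obtain ⟨i, hi⟩ := Function.ne_iff.1 hα
    rw [zero_pow, zero_mul]
    intro h
    exact hi ((Finset.sum_eq_zero_iff.1 h) i (Finset.mem_univ i))

/-! ### Lower bounds for the Bohr radius -/

theorem ENNReal.tsum_pow_sum (n : ℕ) (ρ : ℝ≥0∞) :
    ∑' α : Fin n → ℕ, ρ ^ ∑ i, α i = ((1 - ρ)⁻¹) ^ n := by
  induction n with
  | zero => simp
  | succ n ih =>
    rw [← (Fin.consEquiv fun _ : Fin (n + 1) => ℕ).tsum_eq, ENNReal.tsum_prod']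
    simp only [Fin.consEquiv, Equiv.coe_fn_mk, Fin.sum_univ_succ, Fin.cons_zero, Fin.cons_succ,
      pow_add, ENNReal.tsum_mul_left, ih, ENNReal.tsum_mul_right, ENNReal.tsum_geometric]
    ring_nf

theorem ENNReal.tsum_eq_tsum_sum_piAntidiag {n : ℕ} (f : (Fin n → ℕ) → ℝ≥0∞) :
    ∑' α, f α = ∑' k : ℕ, ∑ α ∈ Finset.piAntidiag Finset.univ k, f α := by
  rw [← (Equiv.sigmaFiberEquiv fun α : Fin n → ℕ => ∑ i, α i).tsum_eq, ENNReal.tsum_sigma']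
  refine tsum_congr fun k => ?_
  simp only [Equiv.sigmaFiberEquiv, Equiv.coe_fn_mk]
  rw [← Finset.tsum_subtype]
  refine (Equiv.subtypeEquivRight fun α => ?_).tsum_eq
    (fun x : {α // α ∈ Finset.piAntidiag Finset.univ k} => f x.1)
  simp [Finset.mem_piAntidiag]

/-- Expand `(1 + ⋯ + 1)^k`: every multinomial coefficient is at least 1. -/
theorem card_piAntidiag_univ_le (n k : ℕ) :
    (Finset.piAntidiag (Finset.univ : Finset (Fin n)) k).card ≤ n ^ k := by
  have h := Finset.sum_pow_eq_sum_piAntidiag (Finset.univ : Finset (Fin n)) (fun _ => (1 : ℕ)) k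
  simp only [Finset.sum_const, Finset.card_univ, Fintype.card_fin, smul_eq_mul, mul_one, one_pow,
    Finset.prod_const_one, Nat.cast_id] at h
  rw [h, Finset.card_eq_sum_ones]
  exact Finset.sum_le_sum fun _ _ => Nat.multinomial_pos _ _

theorem BoundedByOneOn.norm_zero_le {n : ℕ} {c : (Fin n → ℕ) → ℂ}
    {G : Set (Fin n → ℂ)} (hc : BoundedByOneOn c G) (hG : 0 ∈ G) : ‖c 0‖ ≤ 1 := by
  have := hc.two_mul_norm_add_norm_homogeneous_le (z := 0) (fun ζ _ => by
    rwa [show (fun i => ζ * (0 : Fin n → ℂ) i) = 0 by ext; simp]) one_pos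
  linarith [norm_nonneg (∑ α ∈ Finset.piAntidiag Finset.univ 1, powerTerm c 0 α)]

/-- The radius solves `(1 - r)^(-n) = 3/2`, so that the sum of `r^|α|` over nonzero `α` is exactly
`1/2`, which balances the factor 2 in the monomial bound `2 * (1 - ‖c 0‖)`. -/
theorem one_sub_rpow_mem_secondBohrSet {n : ℕ} (hn : n ≠ 0) {G : Set (Fin n → ℂ)} (h0 : 0 ∈ G)
    (hG : ∀ z ∈ G, ∀ w : Fin n → ℂ, (∀ i, ‖w i‖ = 1) → w * z ∈ G) :
    1 - (2 / 3 : ℝ) ^ (1 / (n : ℝ)) ∈ secondBohrSet G := by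
  have hx1 : (2 / 3 : ℝ) ^ (1 / (n : ℝ)) ≤ 1 :=
    Real.rpow_le_one (by norm_num) (by norm_num) (by positivity)
  have hx0 : 0 < (2 / 3 : ℝ) ^ (1 / (n : ℝ)) := by positivity
  have hr : 0 ≤ 1 - (2 / 3 : ℝ) ^ (1 / (n : ℝ)) := by linarith
  refine ⟨hr, fun c hc => ?_⟩
  simp only [iSup_smul_enorm_powerTerm G c hr]
  set ρ := ENNReal.ofReal (1 - (2 / 3 : ℝ) ^ (1 / (n : ℝ))) with hρ
  have hA := hc.norm_zero_le h0
  have hs0 : (⨆ z ∈ G, ‖powerTerm c z 0‖ₑ) ≤ ENNReal.ofReal ‖c 0‖ :=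
    iSup₂_le fun z _ => by rw [powerTerm_zero_index, ofReal_norm]
  have hs : ∀ α : Fin n → ℕ, α ≠ 0 →
      (⨆ z ∈ G, ‖powerTerm c z α‖ₑ) ≤ ENNReal.ofReal (2 * (1 - ‖c 0‖)) := by
    intro α hα
    refine iSup₂_le fun z hz => ?_
    rw [← ofReal_norm]
    refine ENNReal.ofReal_le_ofReal ?_
    have hk : 0 < ∑ i, α i := by
      rw [Nat.pos_iff_ne_zero, Ne, Finset.sum_eq_zero_iff]
      exact fun h => hα (funext fun i => h i (Finset.mem_univ i))
    have h := hc.sum_norm_sq_homogeneous_le (hG z hz) hk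
    refine le_of_sq_le_sq ?_ (by linarith)
    refine le_trans ?_ h
    exact Finset.single_le_sum (f := fun α => ‖powerTerm c z α‖ ^ 2)
      (fun _ _ => by positivity) (by simp [Finset.mem_piAntidiag])
  have htot : 1 + ∑' α : Fin n → ℕ, (if α = 0 then 0 else ρ ^ ∑ i, α i) = ENNReal.ofReal (3 / 2) := by
    have h1 := ENNReal.tsum_eq_add_tsum_ite (f := fun α : Fin n → ℕ => ρ ^ ∑ i, α i) 0
    simp only [Pi.zero_apply, Finset.sum_const_zero, pow_zero] at h1
    have h2 : 1 + ∑' α : Fin n → ℕ, (if α = 0 then 0 else ρ ^ ∑ i, α i)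
        = ∑' α : Fin n → ℕ, ρ ^ ∑ i, α i := by
      rw [h1]
      congr!
    rw [h2, ENNReal.tsum_pow_sum, hρ, ← ENNReal.ofReal_one, ← ENNReal.ofReal_sub _ hr,
      sub_sub_cancel, ← ENNReal.ofReal_inv_of_pos hx0, ← ENNReal.ofReal_pow (by positivity),
      inv_pow, ← Real.rpow_natCast, ← Real.rpow_mul (by norm_num), one_div_mul_cancel
      (by exact_mod_cast hn), Real.rpow_one]
    norm_num
  have hhalf : ∑' α : Fin n → ℕ, (if α = 0 then 0 else ρ ^ ∑ i, α i) = ENNReal.ofReal (1 / 2) := by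
    have : (1 : ℝ≥0∞) + ENNReal.ofReal (1 / 2) = ENNReal.ofReal (3 / 2) := by
      rw [← ENNReal.ofReal_one, ← ENNReal.ofReal_add (by norm_num) (by norm_num)]
      norm_num
    rw [← this] at htot
    exact (ENNReal.add_right_inj ENNReal.one_ne_top).1 htot
  rw [ENNReal.tsum_eq_add_tsum_ite 0]
  calc _ ≤ ENNReal.ofReal ‖c 0‖ + ∑' α : Fin n → ℕ,
        (if α = 0 then 0 else ρ ^ ∑ i, α i) * ENNReal.ofReal (2 * (1 - ‖c 0‖)) := by
        refine add_le_add (by simpa using hs0) (ENNReal.tsum_le_tsum fun α => ?_)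
        split_ifs with h
        · simp
        · exact mul_le_mul_right (hs α h) _
    _ = 1 := by
        rw [ENNReal.tsum_mul_right, hhalf, ← ENNReal.ofReal_mul (by norm_num),
          ← ENNReal.ofReal_add (norm_nonneg _) (by linarith)]
        rw [show ‖c 0‖ + 1 / 2 * (2 * (1 - ‖c 0‖)) = 1 by ring, ENNReal.ofReal_one]

/-- A lower bound for the Bohr radius of a Reinhardt domain between two polydiscs. -/
theorem div_mem_secondBohrSet {n : ℕ} (hn : n ≠ 0) {G : Set (Fin n → ℂ)}
    (hG1 : ∀ z ∈ G, ∀ i, ‖z i‖ ≤ 1) {τ : ℝ} (hτ : 0 < τ)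
    (hG2 : ∀ z : Fin n → ℂ, ∀ t < τ, (∀ i, ‖z i‖ ≤ t) → z ∈ G) :
    τ / (3 * √n) ∈ secondBohrSet G := by
  have hn' : (0 : ℝ) < n := by positivity
  have hsn : 0 < √(n : ℝ) := Real.sqrt_pos.2 hn'
  set r := τ / (3 * √(n : ℝ)) with hr_def
  have hr : 0 ≤ r := by positivity
  refine ⟨hr, fun c hc => ?_⟩
  have hA := hc.norm_zero_le (hG2 0 (τ / 2) (by linarith)
    fun i => by simpa using (half_pos hτ).le)
  have hsq : ∀ k : ℕ, 0 < k →
      (∑ α ∈ Finset.piAntidiag Finset.univ k, ‖c α‖ ^ 2) * τ ^ (2 * k) ≤ (2 * (1 - ‖c 0‖)) ^ 2 := by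
    intro k hk
    -- Only polydiscs of radius `t < τ` are known to lie in `G`, so the bound at `τ` is a limit.
    have hcont : Filter.Tendsto (fun t : ℝ =>
        (∑ α ∈ Finset.piAntidiag (Finset.univ : Finset (Fin n)) k, ‖c α‖ ^ 2) * t ^ (2 * k))
        (nhdsWithin τ (Set.Iio τ)) (nhds ((∑ α ∈ Finset.piAntidiag Finset.univ k, ‖c α‖ ^ 2)
          * τ ^ (2 * k))) :=
      ((continuous_const.mul (continuous_pow _)).tendsto τ).mono_left nhdsWithin_le_nhds
    refine le_of_tendsto hcont ?_
    filter_upwards [Ioo_mem_nhdsLT hτ] with t ht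
    have h := hc.sum_norm_sq_homogeneous_le (z := fun _ => (t : ℂ)) (fun w hw =>
      hG2 _ t ht.2 fun i => by simp [hw, abs_of_pos ht.1]) hk
    refine le_trans (le_of_eq ?_) h
    rw [Finset.sum_mul]
    refine Finset.sum_congr rfl fun α hα => ?_
    have hα' : ∑ i, α i = k := (Finset.mem_piAntidiag.1 hα).1
    rw [powerTerm, Finset.prod_pow_eq_pow_sum, hα', norm_mul, norm_pow, Complex.norm_real,
      Real.norm_of_nonneg ht.1.le]
    ring_nf
  have hk : ∀ k : ℕ, 0 < k → r ^ k * ∑ α ∈ Finset.piAntidiag Finset.univ k, ‖c α‖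
      ≤ (1 / 3) ^ k * (2 * (1 - ‖c 0‖)) := by
    intro k hk
    refine le_of_sq_le_sq ?_ (by have : 0 ≤ 1 - ‖c 0‖ := by linarith
                                 positivity)
    have hcs := sq_sum_le_card_mul_sum_sq (s := Finset.piAntidiag (Finset.univ : Finset (Fin n)) k)
      (f := fun α => ‖c α‖)
    have hcard : ((Finset.piAntidiag (Finset.univ : Finset (Fin n)) k).card : ℝ) ≤ (n : ℝ) ^ k := by
      exact_mod_cast card_piAntidiag_univ_le n k
    set Q := ∑ α ∈ Finset.piAntidiag (Finset.univ : Finset (Fin n)) k, ‖c α‖ ^ 2 with hQ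
    have hQ0 : 0 ≤ Q := Finset.sum_nonneg fun _ _ => by positivity
    calc (r ^ k * ∑ α ∈ Finset.piAntidiag Finset.univ k, ‖c α‖) ^ 2
        ≤ (r ^ k) ^ 2 * ((n : ℝ) ^ k * Q) := by
          rw [mul_pow]
          exact mul_le_mul_of_nonneg_left
            (hcs.trans (mul_le_mul_of_nonneg_right hcard hQ0)) (by positivity)
      -- The choice of `r` makes `r√n = τ / 3`: the factor `√n ^ k` lost in Cauchy–Schwarz is
      -- absorbed and a geometric ratio `1/3` remains.
      _ = ((1 / 3) ^ k) ^ 2 * (Q * τ ^ (2 * k)) := by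
          have : r ^ 2 * n = (1 / 3) ^ 2 * τ ^ 2 := by
            rw [hr_def]
            field_simp
            rw [Real.sq_sqrt hn'.le]
          calc (r ^ k) ^ 2 * ((n : ℝ) ^ k * Q) = (r ^ 2 * n) ^ k * Q := by
                rw [mul_pow, pow_right_comm, mul_assoc]
            _ = _ := by rw [this, mul_pow, ← pow_mul, ← pow_mul, ← pow_mul]; ring
      _ ≤ ((1 / 3) ^ k * (2 * (1 - ‖c 0‖))) ^ 2 := by
          rw [mul_pow]
          exact mul_le_mul_of_nonneg_left (hsq k hk) (by positivity)
  simp only [iSup_smul_enorm_powerTerm G c hr]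
  rw [ENNReal.tsum_eq_tsum_sum_piAntidiag]
  have hle : ∀ k : ℕ, ∑ α ∈ Finset.piAntidiag Finset.univ k,
      ENNReal.ofReal r ^ (∑ i, α i) * ⨆ z ∈ G, ‖powerTerm c z α‖ₑ
      ≤ ENNReal.ofReal (r ^ k * ∑ α ∈ Finset.piAntidiag Finset.univ k, ‖c α‖) := by
    intro k
    rw [ENNReal.ofReal_mul (by positivity), ENNReal.ofReal_pow hr,
      ENNReal.ofReal_sum_of_nonneg fun _ _ => norm_nonneg _, Finset.mul_sum]
    refine Finset.sum_le_sum fun α hα => ?_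
    have hα' : ∑ i, α i = k := (Finset.mem_piAntidiag.1 hα).1
    rw [hα', ofReal_norm]
    exact mul_le_mul_right (iSup₂_le fun z hz => enorm_powerTerm_le c (hG1 z hz) α) _
  have hgeo : HasSum (fun k : ℕ => (1 / 3 : ℝ) ^ (k + 1) * (2 * (1 - ‖c 0‖))) (1 - ‖c 0‖) := by
    have := ((hasSum_geometric_of_lt_one (r := (1 / 3 : ℝ)) (by norm_num) (by norm_num)).mul_left
      (1 / 3)).mul_right (2 * (1 - ‖c 0‖))
    rw [show 1 / 3 * (1 - 1 / 3)⁻¹ * (2 * (1 - ‖c 0‖)) = 1 - ‖c 0‖ by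
      rw [show (1 - 1 / 3 : ℝ)⁻¹ = 3 / 2 by norm_num]; ring] at this
    simpa only [pow_succ'] using this
  rw [tsum_eq_zero_add' ENNReal.summable]
  calc _ ≤ ENNReal.ofReal ‖c 0‖
        + ∑' k : ℕ, ENNReal.ofReal ((1 / 3 : ℝ) ^ (k + 1) * (2 * (1 - ‖c 0‖))) := by
        refine add_le_add ((hle 0).trans (by simp)) (ENNReal.tsum_le_tsum fun k => ?_)
        exact (hle _).trans (ENNReal.ofReal_le_ofReal (hk _ k.succ_pos))
    _ = 1 := by
        have h1 : 0 ≤ 1 - ‖c 0‖ := by linarith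
        rw [← ENNReal.ofReal_tsum_of_nonneg (fun k => by positivity) hgeo.summable, hgeo.tsum_eq,
          ← ENNReal.ofReal_add (norm_nonneg _) h1]
        simp

/-! ### The unit ball of `ℓ_p^n` -/

theorem PiLp.norm_toLp_mono {ι : Type*} [Fintype ι] {p : ℝ≥0∞} [hp : Fact (1 ≤ p)] {z y : ι → ℂ}
    (h : ∀ i, ‖z i‖ ≤ ‖y i‖) :
    ‖(WithLp.toLp p z : PiLp p fun _ : ι => ℂ)‖ ≤ ‖(WithLp.toLp p y : PiLp p fun _ : ι => ℂ)‖ := by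
  rcases eq_or_ne p ∞ with rfl | hp'
  · rw [PiLp.norm_eq_ciSup, PiLp.norm_eq_ciSup]
    exact ciSup_mono (Set.finite_range _).bddAbove h
  · have h0 : 0 < p.toReal := ENNReal.toReal_pos (zero_lt_one.trans_le hp.out).ne' hp'
    rw [PiLp.norm_eq_sum h0, PiLp.norm_eq_sum h0]
    refine Real.rpow_le_rpow (Finset.sum_nonneg fun _ _ => by positivity) ?_ (by positivity)
    exact Finset.sum_le_sum fun i _ => Real.rpow_le_rpow (norm_nonneg _) (h i) h0.le

section

variable {n : ℕ} {p : ℝ≥0∞}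

theorem zero_mem_lpUnitBall (hp : 1 ≤ p) : 0 ∈ lpUnitBall n p := by
  have : Fact (1 ≤ p) := ⟨hp⟩
  change ‖(0 : PiLp p fun _ : Fin n => ℂ)‖ < 1
  simp

theorem norm_le_one_of_mem_lpUnitBall (hp : 1 ≤ p) {z : Fin n → ℂ} (hz : z ∈ lpUnitBall n p)
    (i : Fin n) : ‖z i‖ ≤ 1 := by
  have : Fact (1 ≤ p) := ⟨hp⟩
  exact (PiLp.norm_apply_le (WithLp.toLp p z : PiLp p fun _ : Fin n => ℂ) i).trans (le_of_lt hz)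

theorem mul_mem_lpUnitBall (hp : 1 ≤ p) {z w : Fin n → ℂ} (hz : z ∈ lpUnitBall n p)
    (hw : ∀ i, ‖w i‖ = 1) : w * z ∈ lpUnitBall n p := by
  have : Fact (1 ≤ p) := ⟨hp⟩
  exact (PiLp.norm_toLp_mono fun i => by simp [hw]).trans_lt hz

theorem mem_lpUnitBall_of_norm_le (hn : n ≠ 0) (hp : 1 ≤ p) {z : Fin n → ℂ} {t : ℝ}
    (ht : t < (n : ℝ) ^ (-p⁻¹.toReal)) (hz : ∀ i, ‖z i‖ ≤ t) : z ∈ lpUnitBall n p := by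
  have : Fact (1 ≤ p) := ⟨hp⟩
  have : Nonempty (Fin n) := ⟨⟨0, Nat.pos_of_ne_zero hn⟩⟩
  have hn0 : (0 : ℝ) < n := by positivity
  have ht0 : 0 ≤ t := (norm_nonneg _).trans (hz (Classical.arbitrary _))
  refine (PiLp.norm_toLp_mono (y := Function.const _ (t : ℂ)) fun i => ?_).trans_lt ?_
  · simpa [abs_of_nonneg ht0] using hz i
  · rw [PiLp.norm_toLp_const', Complex.norm_of_nonneg ht0, one_div]
    have hpos : 0 < (n : ℝ) ^ p⁻¹.toReal := by positivity
    have := mul_lt_mul_of_pos_left ht hpos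
    rw [← Real.rpow_add hn0, add_neg_cancel, Real.rpow_zero] at this
    simpa using this

/-- Each entry is at most the ℓ^a norm, so in `x^2 = x^a * x^(2 - a)` the second factor can be
replaced by a power of that norm. -/
theorem sqrt_sum_sq_le_of_le_two {κ : Type*} (s : Finset κ) {x : κ → ℝ} (hx : ∀ j ∈ s, 0 ≤ x j)
    {a : ℝ} (ha : 0 < a) (ha2 : a ≤ 2) : √(∑ j ∈ s, x j ^ 2) ≤ (∑ j ∈ s, x j ^ a) ^ (1 / a) := by
  have hS : 0 ≤ ∑ j ∈ s, x j ^ a := Finset.sum_nonneg fun j hj => Real.rpow_nonneg (hx j hj) _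
  have hle : ∀ j ∈ s, x j ≤ (∑ j ∈ s, x j ^ a) ^ (1 / a) := by
    intro j hj
    have := Finset.single_le_sum (f := fun j => x j ^ a)
      (fun j hj => Real.rpow_nonneg (hx j hj) _) hj
    calc x j = (x j ^ a) ^ (1 / a) := by
          rw [← Real.rpow_mul (hx j hj), mul_one_div_cancel ha.ne', Real.rpow_one]
      _ ≤ _ := Real.rpow_le_rpow (Real.rpow_nonneg (hx j hj) _) this (by positivity)
  set S := ∑ j ∈ s, x j ^ a with hSdef
  have hpow : ∀ y : ℝ, 0 ≤ y → y ^ 2 = y ^ a * y ^ (2 - a) := by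
    intro y hy
    rw [← Real.rpow_add_of_nonneg hy ha.le (by linarith), add_sub_cancel, Real.rpow_two]
  have hT : 0 ≤ S ^ (1 / a) := by positivity
  refine Real.sqrt_le_iff.2 ⟨hT, ?_⟩
  calc ∑ j ∈ s, x j ^ 2 ≤ ∑ j ∈ s, x j ^ a * (S ^ (1 / a)) ^ (2 - a) := by
        refine Finset.sum_le_sum fun j hj => ?_
        rw [hpow _ (hx j hj)]
        exact mul_le_mul_of_nonneg_left
          (Real.rpow_le_rpow (hx j hj) (hle j hj) (by linarith)) (Real.rpow_nonneg (hx j hj) _)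
    _ = (S ^ (1 / a)) ^ 2 := by
        rw [hpow _ hT, ← Finset.sum_mul, ← hSdef, ← Real.rpow_mul hS (1 / a) a,
          one_div_mul_cancel ha.ne', Real.rpow_one]

/-- This is the power mean inequality with exponent `a / 2 ≥ 1` applied to the squares. -/
theorem sqrt_sum_sq_le_of_two_le {κ : Type*} (s : Finset κ) {x : κ → ℝ} (hx : ∀ j ∈ s, 0 ≤ x j)
    {a : ℝ} (ha2 : 2 ≤ a) :
    √(∑ j ∈ s, x j ^ 2) ≤ (s.card : ℝ) ^ (1 / 2 - 1 / a) * (∑ j ∈ s, x j ^ a) ^ (1 / a) := by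
  have ha : 0 < a := by linarith
  have h := Real.rpow_sum_le_const_mul_sum_rpow_of_nonneg s (f := fun j => x j ^ 2) (p := a / 2)
    (by linarith) fun j _ => by positivity
  have hx' : ∀ j ∈ s, (x j ^ 2) ^ (a / 2) = x j ^ a := by
    intro j hj
    rw [← Real.rpow_two, ← Real.rpow_mul (hx j hj)]
    congr 1; ring
  rw [Finset.sum_congr rfl hx'] at h
  have hS : 0 ≤ ∑ j ∈ s, x j ^ a := Finset.sum_nonneg fun j hj => Real.rpow_nonneg (hx j hj) _
  have h0 : 0 ≤ ∑ j ∈ s, x j ^ 2 := Finset.sum_nonneg fun j hj => by positivity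
  have h2 := Real.rpow_le_rpow (by positivity) h (z := 1 / a) (by positivity)
  rw [← Real.rpow_mul h0, Real.mul_rpow (by positivity) hS, ← Real.rpow_mul (by positivity),
    show a / 2 * (1 / a) = 1 / 2 by field_simp,
    show (a / 2 - 1) * (1 / a) = 1 / 2 - 1 / a by field_simp, ← Real.sqrt_eq_rpow] at h2
  exact h2

theorem prod_le_inv_card_pow {κ : Type*} [Fintype κ] [Nonempty κ] {x : κ → ℝ} (hx : ∀ i, 0 ≤ x i)
    (hsum : ∑ i, x i ≤ 1) : ∏ i, x i ≤ ((Fintype.card κ : ℝ)⁻¹) ^ Fintype.card κ := by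
  have hc : (0 : ℝ) < Fintype.card κ := by exact_mod_cast Fintype.card_pos
  have h := Real.geom_mean_le_arith_mean_weighted Finset.univ (fun _ => (Fintype.card κ : ℝ)⁻¹) x
    (fun _ _ => by positivity) (by simp) (fun i _ => hx i)
  rw [← Finset.mul_sum] at h
  have h2 := pow_le_pow_left₀ (Finset.prod_nonneg fun i _ => Real.rpow_nonneg (hx i) _)
    (h.trans (mul_le_of_le_one_right (by positivity) hsum)) (Fintype.card κ)
  refine le_trans (le_of_eq ?_) h2
  rw [← Finset.prod_pow]
  refine Finset.prod_congr rfl fun i _ => ?_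
  rw [← Real.rpow_natCast, ← Real.rpow_mul (hx i), inv_mul_cancel₀ hc.ne', Real.rpow_one]

/-- Comparing ℓ² with ℓ^p inside a block of size `m` costs `m^h`. The `p`-th powers of the `d` block
norms sum to at most 1, so AM–GM bounds their product by `d^(-d)`, which contributes `d^(-1/p)` per
block. -/
theorem prod_sqrt_sum_sq_le (hp : 1 ≤ p) {d m : ℕ} (hd : d ≠ 0) (hm : m ≠ 0)
    {φ : Fin d × Fin m → Fin n} (hφ : Function.Injective φ) {h : ℝ}
    (hh : p ≤ 2 ∧ h = 0 ∨ 2 ≤ p ∧ h = 1 / 2 - p⁻¹.toReal) {z : Fin n → ℂ}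
    (hz : z ∈ lpUnitBall n p) :
    ∏ i, √(∑ j, ‖z (φ (i, j))‖ ^ 2) ≤ ((m : ℝ) ^ h * (d : ℝ) ^ (-p⁻¹.toReal)) ^ d := by
  have : Nonempty (Fin d) := ⟨⟨0, Nat.pos_of_ne_zero hd⟩⟩
  have hd0 : (0 : ℝ) < d := by positivity
  rcases eq_or_ne p ∞ with rfl | hp'
  · have hh' : h = 1 / 2 := by
      rcases hh with ⟨h1, -⟩ | ⟨-, h2⟩
      · simp at h1
      · simpa using h2
    have hle : ∀ i, √(∑ j, ‖z (φ (i, j))‖ ^ 2) ≤ (m : ℝ) ^ h := by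
      intro i
      rw [hh', ← Real.sqrt_eq_rpow]
      refine Real.sqrt_le_sqrt ?_
      refine (Finset.sum_le_sum (g := fun _ => 1) fun j _ =>
        pow_le_one₀ (norm_nonneg _) (norm_le_one_of_mem_lpUnitBall hp hz _)).trans (by simp)
    refine (Finset.prod_le_prod (fun _ _ => Real.sqrt_nonneg _) fun i _ => hle i).trans ?_
    simp
  · have hq : p⁻¹.toReal = 1 / p.toReal := by rw [ENNReal.toReal_inv, one_div]
    have ha : 0 < p.toReal := ENNReal.toReal_pos (zero_lt_one.trans_le hp).ne' hp'
    set a := p.toReal with ha_def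
    have hblock : ∀ i, √(∑ j, ‖z (φ (i, j))‖ ^ 2)
        ≤ (m : ℝ) ^ h * (∑ j, ‖z (φ (i, j))‖ ^ a) ^ (1 / a) := by
      intro i
      rcases hh with ⟨h1, rfl⟩ | ⟨h1, rfl⟩
      · rw [Real.rpow_zero, one_mul]
        refine sqrt_sum_sq_le_of_le_two _ (fun _ _ => norm_nonneg _) ha ?_
        simpa using ENNReal.toReal_mono (by simp) h1
      · have := sqrt_sum_sq_le_of_two_le Finset.univ (x := fun j => ‖z (φ (i, j))‖)
          (fun _ _ => norm_nonneg _) (a := a) (by simpa using ENNReal.toReal_mono hp' h1)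
        rw [hq]
        simpa using this
    refine (Finset.prod_le_prod (fun _ _ => Real.sqrt_nonneg _) fun i _ => hblock i).trans ?_
    rw [Finset.prod_mul_distrib, mul_pow, Finset.prod_const, Finset.card_univ, Fintype.card_fin]
    refine mul_le_mul_of_nonneg_left ?_ (by positivity)
    rw [Real.finsetProd_rpow _ _ fun i _ => Finset.sum_nonneg fun _ _ => by positivity]
    have hsum : ∑ i, ∑ j, ‖z (φ (i, j))‖ ^ a ≤ 1 := by
      have h1 : ‖(WithLp.toLp p z : PiLp p fun _ : Fin n => ℂ)‖ < 1 := hz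
      rw [PiLp.norm_eq_sum ha] at h1
      have h2 : ∑ l, ‖z l‖ ^ a ≤ 1 := by
        by_contra! hcon
        exact absurd h1 (not_lt.2 (Real.one_le_rpow hcon.le (by positivity)))
      refine le_trans ?_ h2
      rw [← Fintype.sum_prod_type', ← Finset.sum_image (f := fun l => ‖z l‖ ^ a) hφ.injOn]
      exact Finset.sum_le_univ_sum_of_nonneg fun _ => by positivity
    have h3 := prod_le_inv_card_pow (x := fun i => ∑ j, ‖z (φ (i, j))‖ ^ a)
      (fun i => Finset.sum_nonneg fun _ _ => by positivity) hsum
    rw [Fintype.card_fin] at h3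
    refine (Real.rpow_le_rpow (Finset.prod_nonneg fun i _ =>
      Finset.sum_nonneg fun _ _ => by positivity) h3 (by positivity)).trans (le_of_eq ?_)
    rw [hq, ← Real.rpow_natCast, ← Real.rpow_natCast, Real.rpow_neg hd0.le, Real.inv_rpow hd0.le,
      Real.inv_rpow (by positivity), Real.inv_rpow (by positivity), ← Real.rpow_mul hd0.le,
      ← Real.rpow_mul hd0.le, mul_comm]

/-- This point spreads its mass equally over `s`; as `t → 1` it provides the lower bound for the
supremum of a squarefree monomial supported on `s`. -/
theorem ite_mem_lpUnitBall (hp : 1 ≤ p) (s : Finset (Fin n)) (hs : s.Nonempty) {t : ℝ}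
    (ht0 : 0 ≤ t) (ht1 : t < 1) :
    (fun l => if l ∈ s then ((t * (s.card : ℝ) ^ (-p⁻¹.toReal) : ℝ) : ℂ) else 0)
      ∈ lpUnitBall n p := by
  have hc : (0 : ℝ) < s.card := by exact_mod_cast hs.card_pos
  rcases eq_or_ne p ∞ with rfl | hp'
  · have : Nonempty (Fin n) := ⟨hs.choose⟩
    change ‖(WithLp.toLp ∞ _ : PiLp ∞ fun _ : Fin n => ℂ)‖ < 1
    rw [PiLp.norm_eq_ciSup]
    refine lt_of_le_of_lt (ciSup_le fun l => ?_) ht1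
    dsimp only
    split_ifs
    · simp [abs_of_nonneg ht0]
    · simpa using ht0
  · have hq : p⁻¹.toReal = 1 / p.toReal := by rw [ENNReal.toReal_inv, one_div]
    have ha : 0 < p.toReal := ENNReal.toReal_pos (zero_lt_one.trans_le hp).ne' hp'
    change ‖(WithLp.toLp p _ : PiLp p fun _ : Fin n => ℂ)‖ < 1
    rw [PiLp.norm_eq_sum ha]
    have : ∀ l : Fin n, ‖(if l ∈ s then ((t * (s.card : ℝ) ^ (-p⁻¹.toReal) : ℝ) : ℂ) else 0)‖
        ^ p.toReal = if l ∈ s then t ^ p.toReal * (s.card : ℝ)⁻¹ else 0 := by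
      intro l
      split_ifs
      · rw [Complex.norm_of_nonneg (by positivity), Real.mul_rpow ht0 (by positivity),
          ← Real.rpow_mul hc.le, hq, neg_mul, one_div_mul_cancel ha.ne', Real.rpow_neg_one]
      · rw [norm_zero, Real.zero_rpow ha.ne']
    simp only [this]
    rw [Finset.sum_ite_mem, Finset.univ_inter, Finset.sum_const, nsmul_eq_mul, mul_left_comm,
      mul_inv_cancel₀ hc.ne', mul_one, ← Real.rpow_mul ht0, mul_one_div_cancel ha.ne',
      Real.rpow_one]
    exact ht1

end

/-! ### Upper bounds for the Bohr radius from multilinear forms -/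

/-- The exponent of the squarefree monomial `∏ i, z (ψ i)`. -/
def indexOf {n d : ℕ} (ψ : Fin d → Fin n) (l : Fin n) : ℕ :=
  ∑ i, if ψ i = l then 1 else 0

theorem prod_pow_indexOf {n d : ℕ} (ψ : Fin d → Fin n) (z : Fin n → ℂ) :
    ∏ l, z l ^ indexOf ψ l = ∏ i, z (ψ i) := by
  simp only [indexOf, ← Finset.prod_pow_eq_pow_sum]
  rw [Finset.prod_comm]
  refine Finset.prod_congr rfl fun i _ => ?_
  simp [pow_ite]

/-- The exponent at `φ (i, j)` is the indicator of `J i = j`, so the monomial determines `J`. -/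
theorem indexOf_injective {n d m : ℕ} {φ : Fin d × Fin m → Fin n} (hφ : Function.Injective φ) :
    Function.Injective fun J : Fin d → Fin m => indexOf fun i => φ (i, J i) := by
  have h : ∀ (J : Fin d → Fin m) i j, indexOf (fun i => φ (i, J i)) (φ (i, j))
      = if J i = j then 1 else 0 := by
    intro J i j
    rw [indexOf, Finset.sum_eq_single i]
    · simp [hφ.eq_iff]
    · intro b _ hb
      simp [hφ.eq_iff, hb]
    · simp
  intro J K hJK
  funext i
  have h1 := congrFun hJK (φ (i, K i))
  simp only [h] at h1
  by_contra hne
  simp [hne] at h1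

/-- A `d`-linear form with unimodular coefficients bounded by `N` on products of Euclidean balls
bounds the elements of the set defining the Bohr radius of the unit ball of `ℓ_p^n`. -/
theorem pow_le_of_mem_secondBohrSet {n : ℕ} {p : ℝ≥0∞} (hp : 1 ≤ p) {d m : ℕ} (hd : d ≠ 0)
    (hm : m ≠ 0) (hdm : d * m ≤ n) {h : ℝ}
    (hh : p ≤ 2 ∧ h = 0 ∨ 2 ≤ p ∧ h = 1 / 2 - p⁻¹.toReal)
    {T : (Fin d → Fin m) → ℂ} (hT : ∀ J, ‖T J‖ = 1) {N : ℝ} (hN : 0 < N)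
    (hTN : ∀ x : Fin d → Fin m → ℂ,
      ‖∑ J, T J * ∏ i, x i (J i)‖ ≤ N * ∏ i, √(∑ j, ‖x i j‖ ^ 2))
    {r : ℝ} (hr : r ∈ secondBohrSet (lpUnitBall n p)) : ((m : ℝ) ^ (1 - h) * r) ^ d ≤ N := by
  obtain ⟨hr0, hr⟩ := hr
  have hd0 : (0 : ℝ) < d := by positivity
  have hm0 : (0 : ℝ) < m := by positivity
  have : Nonempty (Fin d) := ⟨⟨0, Nat.pos_of_ne_zero hd⟩⟩
  let φ : Fin d × Fin m → Fin n := fun x => Fin.castLE hdm (finProdFinEquiv x)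
  have hφ : Function.Injective φ :=
    (Fin.castLE_injective hdm).comp finProdFinEquiv.injective
  let A : (Fin d → Fin m) → Fin n → ℕ := fun J => indexOf fun i => φ (i, J i)
  have hA : Function.Injective A := indexOf_injective hφ
  set δ : ℝ := (d : ℝ) ^ (-p⁻¹.toReal) with hδ
  have hδ0 : 0 < δ := by positivity
  -- `κ` bounds the product of the Euclidean block norms on the ball, so dividing the form by `N *
  -- κ` makes it bounded by one.
  set κ : ℝ := ((m : ℝ) ^ h * δ) ^ d with hκ
  have hκ0 : 0 < κ := by positivity
  let c : (Fin n → ℕ) → ℂ := fun α => ∑ J, if α = A J then T J / (N * κ : ℝ) else 0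
  have hcA : ∀ J, c (A J) = T J / (N * κ : ℝ) := by
    intro J
    simp only [c, hA.eq_iff]
    simp
  have hsum : ∀ z : Fin n → ℂ, HasSum (powerTerm c z)
      (∑ J, T J / (N * κ : ℝ) * ∏ i, z (φ (i, J i))) := by
    intro z
    have : powerTerm c z = fun α =>
        ∑ J, (if α = A J then T J / (N * κ : ℝ) * ∏ l, z l ^ α l else 0) := by
      funext α
      simp only [powerTerm, c, Finset.sum_mul, ite_mul, zero_mul]
    rw [this]
    refine hasSum_sum fun J _ => ?_
    rw [← prod_pow_indexOf]
    convert hasSum_single (f := fun α => if α = A J then T J / ((N * κ : ℝ) : ℂ) *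
      ∏ l, z l ^ α l else 0) (A J) (fun α hα => by simp [hα]) using 1
    simp [A]
  have hc : BoundedByOneOn c (lpUnitBall n p) := by
    intro z hz
    refine ⟨(hsum z).summable, ?_⟩
    rw [(hsum z).tsum_eq]
    have h1 := hTN fun i j => z (φ (i, j))
    have h2 := prod_sqrt_sum_sq_le hp hd hm hφ hh hz
    have h3 : ∑ J, T J / ((N * κ : ℝ) : ℂ) * ∏ i, z (φ (i, J i))
        = (∑ J, T J * ∏ i, z (φ (i, J i))) / ((N * κ : ℝ) : ℂ) := by
      rw [Finset.sum_div]
      exact Finset.sum_congr rfl fun J _ => by ring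
    rw [h3, norm_div, Complex.norm_of_nonneg (by positivity), div_le_one (by positivity)]
    exact h1.trans (mul_le_mul_of_nonneg_left h2 hN.le)
  have hS := hr c hc
  have hterm : ∀ t : ℝ, 0 ≤ t → t < 1 → ∀ J, ENNReal.ofReal ((r * (t * δ)) ^ d / (N * κ))
      ≤ ⨆ z ∈ r • lpUnitBall n p, ‖powerTerm c z (A J)‖ₑ := by
    intro t ht0 ht1 J
    let s : Finset (Fin n) := Finset.univ.image fun i => φ (i, J i)
    have hs : s.card = d := by
      rw [Finset.card_image_of_injective _ fun i j hij => congrArg Prod.fst (hφ hij)]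
      simp
    have hmem := ite_mem_lpUnitBall (p := p) hp s (Finset.univ_nonempty.image _) ht0 ht1
    refine le_trans ?_ (le_iSup₂ (f := fun z _ => ‖powerTerm c z (A J)‖ₑ) _
      (Set.smul_mem_smul_set (a := r) hmem))
    rw [← ofReal_norm]
    refine ENNReal.ofReal_le_ofReal (le_of_eq ?_)
    rw [powerTerm, prod_pow_indexOf, hcA, norm_mul, norm_div, hT,
      Complex.norm_of_nonneg (by positivity), norm_prod]
    have : ∀ i, φ (i, J i) ∈ s := fun i => Finset.mem_image_of_mem _ (Finset.mem_univ i)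
    simp only [Pi.smul_apply, this, if_true, hs, norm_smul, ← hδ]
    rw [Complex.norm_of_nonneg (by positivity), Real.norm_of_nonneg hr0]
    simp only [Finset.prod_const, Finset.card_univ, Fintype.card_fin]
    ring
  have hfin : ∀ t : ℝ, 0 ≤ t → t < 1 → ((m : ℝ) * (r * t)) ^ d ≤ N * ((m : ℝ) ^ h) ^ d := by
    intro t ht0 ht1
    have h1 : ∑ _J : Fin d → Fin m, ENNReal.ofReal ((r * (t * δ)) ^ d / (N * κ)) ≤ 1 := by
      refine le_trans ?_ hS
      refine le_trans (Finset.sum_le_sum fun J _ => hterm t ht0 ht1 J) ?_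
      rw [← tsum_fintype (L := .unconditional _)]
      exact ENNReal.tsum_comp_le_tsum_of_injective hA _
    rw [← ENNReal.ofReal_sum_of_nonneg (fun _ _ => by positivity), ENNReal.ofReal_le_one] at h1
    simp only [Finset.sum_const, Finset.card_univ, Fintype.card_fun, Fintype.card_fin,
      nsmul_eq_mul, Nat.cast_pow] at h1
    rw [mul_div_assoc', div_le_one (by positivity)] at h1
    -- The factor `δ^d` occurs both in the size of the monomials and in `κ`, and cancels.
    have h2 : (m * (r * t)) ^ d * δ ^ d ≤ (N * ((m : ℝ) ^ h) ^ d) * δ ^ d := by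
      rw [hκ] at h1
      calc _ = (m : ℝ) ^ d * (r * (t * δ)) ^ d := by rw [← mul_pow, ← mul_pow]; ring_nf
        _ ≤ _ := h1
        _ = _ := by rw [mul_pow]; ring
    exact le_of_mul_le_mul_right h2 (by positivity)
  have hlim : ((m : ℝ) * (r * 1)) ^ d ≤ N * ((m : ℝ) ^ h) ^ d := by
    have hcont : Filter.Tendsto (fun t : ℝ => ((m : ℝ) * (r * t)) ^ d)
        (nhdsWithin 1 (Set.Iio 1)) (nhds (((m : ℝ) * (r * 1)) ^ d)) :=
      ((by fun_prop : Continuous fun t : ℝ => ((m : ℝ) * (r * t)) ^ d).tendsto 1).mono_left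
        nhdsWithin_le_nhds
    refine le_of_tendsto hcont ?_
    filter_upwards [Ioo_mem_nhdsLT one_pos] with t ht
    exact hfin t ht.1.le ht.2
  have hpos : 0 < ((m : ℝ) ^ h) ^ d := by positivity
  refine le_of_mul_le_mul_right (le_trans (le_of_eq ?_) hlim) hpos
  rw [← mul_pow, mul_one, mul_right_comm, ← Real.rpow_add hm0, sub_add_cancel, Real.rpow_one]

/-- The case `d = m = 1` of the previous bound: the test function is a multiple of one coordinate.
-/
theorem le_one_of_mem_secondBohrSet {n : ℕ} (hn : n ≠ 0) {p : ℝ≥0∞} (hp : 1 ≤ p) {r : ℝ}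
    (hr : r ∈ secondBohrSet (lpUnitBall n p)) : r ≤ 1 := by
  obtain ⟨h, hh⟩ : ∃ h : ℝ, p ≤ 2 ∧ h = 0 ∨ 2 ≤ p ∧ h = 1 / 2 - p⁻¹.toReal := by
    rcases le_total p 2 with h | h
    · exact ⟨_, Or.inl ⟨h, rfl⟩⟩
    · exact ⟨_, Or.inr ⟨h, rfl⟩⟩
  have := pow_le_of_mem_secondBohrSet hp (d := 1) (m := 1) one_ne_zero one_ne_zero (by omega) hh
    (T := fun _ => 1) (by simp) one_pos (fun x => by simp [Real.sqrt_sq]) hr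
  simpa using this

/-! ### Multilinear forms with unimodular coefficients and small norm -/

open Finset in
/-- Among the forms whose coefficients are roots of unity there is one whose norm on products of
Euclidean balls is small: the average of the `2q`-th powers of these norms is controlled by
expanding `q`-th powers and grouping monomials. -/
theorem exists_unimodular_pow_le (d m q : ℕ) : ∃ T : (Fin d → Fin m) → ℂ, (∀ J, ‖T J‖ = 1) ∧
    ∀ x : Fin d → Fin m → ℂ, (‖∑ J, T J * ∏ i, x i (J i)‖ ^ q) ^ 2
      ≤ (q.factorial * (q + 1) ^ (d * m) : ℕ) * (∏ i, ∑ j, ‖x i j‖ ^ 2) ^ q := by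
  classical
  let P : Finset ((Fin d → Fin m) → ℕ) := piAntidiag univ q
  let μ : ((Fin d → Fin m) → ℕ) → ℕ := Nat.multinomial univ
  -- Many products of `q` monomials of the form yield the same monomial in `x`; `β γ` is its
  -- exponent. `A w b` is the coefficient of `x^b` in the `q`-th power of the form, and `W b` is the
  -- same coefficient with all signs equal to 1.
  let β : ((Fin d → Fin m) → ℕ) → Fin d → Fin m → ℕ :=
    fun γ i j => ∑ J, if J i = j then γ J else 0
  let W : (Fin d → Fin m → ℕ) → ℝ := fun b => ∑ γ ∈ P with β γ = b, (μ γ : ℝ)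
  let χ : ((Fin d → Fin m) → ZMod (q + 1)) → ((Fin d → Fin m) → ℕ) → ℂ :=
    fun w γ => ∏ J, (ZMod.stdAddChar (w J) : ℂ) ^ γ J
  let A : ((Fin d → Fin m) → ZMod (q + 1)) → (Fin d → Fin m → ℕ) → ℂ :=
    fun w b => ∑ γ ∈ P with β γ = b, (μ γ : ℂ) * χ w γ
  have hPsum : ∀ γ ∈ P, ∑ J, γ J = q := fun γ hγ => (mem_piAntidiag.1 hγ).1
  have hPlt : ∀ γ ∈ P, ∀ J, γ J < q + 1 := by
    intro γ hγ J
    rw [← hPsum γ hγ, Nat.lt_succ_iff]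
    exact single_le_sum (f := γ) (fun _ _ => Nat.zero_le _) (mem_univ J)
  have hμ : ∀ γ ∈ P, μ γ ≤ q.factorial := by
    intro γ hγ
    rw [← hPsum γ hγ]
    exact Nat.div_le_self _ _
  have hW : ∀ b ∈ P.image β, 0 < W b := by
    intro b hb
    obtain ⟨γ, hγ, rfl⟩ := mem_image.1 hb
    refine sum_pos (fun γ _ => by exact_mod_cast Nat.multinomial_pos _ _) ⟨γ, ?_⟩
    simp [hγ]
  have hcard : (P.image β).card ≤ (q + 1) ^ (d * m) := by
    have hsub : P.image β ⊆ Fintype.piFinset fun _ => Fintype.piFinset fun _ => range (q + 1) := by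
      intro b hb
      obtain ⟨γ, hγ, rfl⟩ := mem_image.1 hb
      simp only [Fintype.mem_piFinset, mem_range, Nat.lt_succ_iff]
      intro i j
      rw [← hPsum γ hγ]
      exact sum_le_sum fun J _ => by split_ifs <;> simp
    refine (card_le_card hsub).trans (le_of_eq ?_)
    simp [pow_mul, mul_comm d m]
  -- By Parseval the mean of `‖A w b‖^2` is the sum of `μ γ ^ 2`, at most `q! * W b` since `μ γ ≤
  -- q!`. Summing over the at most `(q + 1)^(d * m)` exponents `b` bounds the mean, and some `w`
  -- does no worse than the mean.
  have havg : ∑ w, ∑ b ∈ P.image β, ‖A w b‖ ^ 2 / W b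
      ≤ ∑ _w : (Fin d → Fin m) → ZMod (q + 1),
        ((q.factorial * (q + 1) ^ (d * m) : ℕ) : ℝ) := by
    rw [sum_comm]
    have hb : ∀ b ∈ P.image β, ∑ w, ‖A w b‖ ^ 2 / W b
        ≤ ((q + 1 : ℕ) : ℝ) ^ Fintype.card (Fin d → Fin m) * q.factorial := by
      intro b hb
      rw [← sum_div, div_le_iff₀ (hW b hb)]
      have h := sum_norm_sq_sum_mul_prod_stdAddChar (q + 1) (P.filter fun γ => β γ = b)
        (fun γ hγ => hPlt γ (mem_filter.1 hγ).1) (fun γ => (μ γ : ℂ))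
      rw [h, mul_assoc]
      refine mul_le_mul_of_nonneg_left ?_ (by positivity)
      simp only [W]
      rw [mul_sum]
      refine sum_le_sum fun γ hγ => ?_
      rw [Complex.norm_natCast, sq]
      exact mul_le_mul_of_nonneg_right (by exact_mod_cast hμ γ (mem_filter.1 hγ).1) (by positivity)
    refine (sum_le_sum hb).trans ?_
    rw [sum_const, sum_const, nsmul_eq_mul, nsmul_eq_mul, card_univ, Fintype.card_fun (α := Fin d → Fin m),
      ZMod.card]
    have : ((P.image β).card : ℝ) ≤ ((q + 1) ^ (d * m) : ℕ) := by exact_mod_cast hcard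
    push_cast at this ⊢
    calc _ ≤ ((q : ℝ) + 1) ^ (d * m) * (((q : ℝ) + 1) ^ Fintype.card (Fin d → Fin m)
          * q.factorial) := mul_le_mul_of_nonneg_right this (by positivity)
      _ = _ := by ring
  obtain ⟨w, -, hw⟩ := exists_le_of_sum_le univ_nonempty havg
  refine ⟨fun J => ZMod.stdAddChar (w J), fun J => AddChar.norm_apply _ _, fun x => ?_⟩
  have hmono : ∀ (y : Fin d → Fin m → ℂ) γ,
      ∏ J : Fin d → Fin m, (∏ i, y i (J i)) ^ γ J = ∏ i, ∏ j, y i j ^ β γ i j := by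
    intro y γ
    simp only [← prod_pow]
    rw [prod_comm]
    refine prod_congr rfl fun i _ => ?_
    simp only [β, ← prod_pow_eq_pow_sum]
    rw [prod_comm]
    refine prod_congr rfl fun J _ => ?_
    simp [pow_ite]
  have hF : (∑ J, (ZMod.stdAddChar (w J) : ℂ) * ∏ i, x i (J i)) ^ q
      = ∑ b ∈ P.image β, A w b * ∏ i, ∏ j, x i j ^ b i j := by
    rw [sum_pow_eq_sum_piAntidiag,
      ← sum_fiberwise_of_maps_to (g := β) (t := P.image β) fun γ hγ => mem_image_of_mem β hγ]
    refine sum_congr rfl fun b _ => ?_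
    simp only [A]
    rw [sum_mul]
    refine sum_congr rfl fun γ hγ => ?_
    simp only [mul_pow, prod_mul_distrib, hmono, (mem_filter.1 hγ).2]
    ring
  have hX : ∑ b ∈ P.image β, W b * ‖∏ i, ∏ j, x i j ^ b i j‖ ^ 2
      = (∏ i, ∑ j, ‖x i j‖ ^ 2) ^ q := by
    have h1 : ∏ i, ∑ j, ‖x i j‖ ^ 2 = ∑ J : Fin d → Fin m, ‖∏ i, x i (J i)‖ ^ 2 := by
      rw [Fintype.prod_sum]
      simp only [norm_prod, prod_pow]
    rw [h1, sum_pow_eq_sum_piAntidiag,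
      ← sum_fiberwise_of_maps_to (g := β) (t := P.image β) fun γ hγ => mem_image_of_mem β hγ]
    refine sum_congr rfl fun b _ => ?_
    simp only [W]
    rw [sum_mul]
    refine sum_congr rfl fun γ hγ => ?_
    rw [← (mem_filter.1 hγ).2, ← hmono, norm_prod, ← prod_pow]
    simp only [norm_pow, ← pow_mul, mul_comm]
    rfl
  rw [← norm_pow, hF, ← hX]
  -- Cauchy–Schwarz weighted by `W`: the first factor no longer involves `x`, and the second sums
  -- exactly to the power of the Euclidean norms by `hX`.
  have hcs := sum_mul_sq_le_sq_mul_sq (P.image β) (fun b => ‖A w b‖ / √(W b))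
    (fun b => √(W b) * ‖∏ i, ∏ j, x i j ^ b i j‖)
  have e1 : ∀ b ∈ P.image β, ‖A w b‖ / √(W b) * (√(W b) * ‖∏ i, ∏ j, x i j ^ b i j‖)
      = ‖A w b * ∏ i, ∏ j, x i j ^ b i j‖ := by
    intro b hb
    have := Real.sqrt_pos.2 (hW b hb)
    rw [norm_mul]
    field_simp
  have e2 : ∀ b ∈ P.image β, (‖A w b‖ / √(W b)) ^ 2 = ‖A w b‖ ^ 2 / W b := by
    intro b hb
    rw [div_pow, Real.sq_sqrt (hW b hb).le]
  have e3 : ∀ b ∈ P.image β, (√(W b) * ‖∏ i, ∏ j, x i j ^ b i j‖) ^ 2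
      = W b * ‖∏ i, ∏ j, x i j ^ b i j‖ ^ 2 := by
    intro b hb
    rw [mul_pow, Real.sq_sqrt (hW b hb).le]
  rw [sum_congr rfl e1, sum_congr rfl e2, sum_congr rfl e3] at hcs
  refine (pow_le_pow_left₀ (norm_nonneg _) (norm_sum_le _ _) 2).trans (hcs.trans ?_)
  exact mul_le_mul_of_nonneg_right hw
    (sum_nonneg fun b hb => mul_nonneg (hW b hb).le (by positivity))

/-- Induction from Bernoulli's `(1 + 1/q)^q ≥ 2`. The start is 6 because the inequality fails at 5.
-/
theorem two_pow_mul_factorial_le {q : ℕ} (hq : 6 ≤ q) : 2 ^ q * q.factorial ≤ q ^ q := by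
  induction q, hq using Nat.le_induction with
  | base => decide
  | succ q hq ih =>
    have h : 2 * q ^ q ≤ (q + 1) ^ q := by
      have h1 : (0 : ℝ) < q := by exact_mod_cast (by omega : 0 < q)
      have h2 := one_add_mul_le_pow (a := (1 : ℝ) / q) (by have : (0 : ℝ) ≤ 1 / q := by positivity
                                                           linarith) q
      rw [mul_one_div_cancel h1.ne'] at h2
      have h3 := mul_le_mul_of_nonneg_right h2 (by positivity : (0 : ℝ) ≤ (q : ℝ) ^ q)
      rw [← mul_pow, show (1 + 1 / (q : ℝ)) * q = q + 1 by field_simp] at h3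
      have h4 : (2 : ℝ) * q ^ q ≤ (q + 1) ^ q := by linarith
      exact_mod_cast h4
    calc 2 ^ (q + 1) * (q + 1).factorial = 2 * (q + 1) * (2 ^ q * q.factorial) := by
          rw [Nat.factorial_succ]; ring
      _ ≤ 2 * (q + 1) * q ^ q := Nat.mul_le_mul_left _ ih
      _ = (q + 1) * (2 * q ^ q) := by ring
      _ ≤ (q + 1) * (q + 1) ^ q := Nat.mul_le_mul_left _ h
      _ = _ := by ring

/-- It fails at `M = 4`, whence the hypothesis `5 ≤ d * m` on the forms. -/
theorem sq_add_one_le_two_pow {M : ℕ} (hM : 5 ≤ M) : M ^ 2 + 1 ≤ 2 ^ M := by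
  induction M, hM using Nat.le_induction with
  | base => decide
  | succ M hM ih =>
    rw [pow_succ 2 M]
    nlinarith

/-- There is a `d`-linear form on `ℂ^m` with unimodular coefficients and norm at most `d * m`. -/
theorem exists_unimodular_norm_le {d m : ℕ} (hdm : 5 ≤ d * m) :
    ∃ T : (Fin d → Fin m) → ℂ, (∀ J, ‖T J‖ = 1) ∧ ∀ x : Fin d → Fin m → ℂ,
      ‖∑ J, T J * ∏ i, x i (J i)‖ ≤ (d * m : ℕ) * ∏ i, √(∑ j, ‖x i j‖ ^ 2) := by
  set M := d * m with hM
  -- With `q = M^2` one has `(q + 1)^M ≤ 2^(M^2) = 2^q`, so the constant is at most `2^q * q! ≤ q^q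
  -- = M^(2q)`, and taking the `2q`-th root leaves `M`.
  obtain ⟨T, hT, h⟩ := exists_unimodular_pow_le d m (M ^ 2)
  refine ⟨T, hT, fun x => ?_⟩
  have hq : (M ^ 2).factorial * (M ^ 2 + 1) ^ M ≤ (M ^ 2) ^ (M ^ 2) := by
    calc _ ≤ (M ^ 2).factorial * (2 ^ M) ^ M :=
          Nat.mul_le_mul_left _ (Nat.pow_le_pow_left (sq_add_one_le_two_pow hdm) _)
      _ = 2 ^ (M ^ 2) * (M ^ 2).factorial := by rw [← pow_mul, sq, mul_comm]
      _ ≤ _ := two_pow_mul_factorial_le (by nlinarith)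
  have hsq : ∏ i, ∑ j, ‖x i j‖ ^ 2 = (∏ i, √(∑ j, ‖x i j‖ ^ 2)) ^ 2 := by
    rw [← Finset.prod_pow]
    exact Finset.prod_congr rfl fun i _ =>
      (Real.sq_sqrt (Finset.sum_nonneg fun _ _ => by positivity)).symm
  have h1 := (h x).trans (mul_le_mul_of_nonneg_right (Nat.cast_le.2 hq) (by positivity))
  rw [hsq, ← pow_mul, mul_comm (M ^ 2) 2, pow_mul] at h1
  push_cast at h1
  rw [← mul_pow, ← mul_pow] at h1
  have hM0 : M ^ 2 ≠ 0 := by positivity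
  have h2 := le_of_pow_le_pow_left₀ hM0 (by positivity) h1
  exact le_of_sq_le_sq h2 (mul_nonneg (Nat.cast_nonneg _)
    (Finset.prod_nonneg fun _ _ => Real.sqrt_nonneg _))

/-! ### Numerical estimates -/

/-- Equivalent to `e^n < n^4`, which is reversed at `n = 9`; this dictates the split between 8 and
9. For these `n` the upper bound for the radius exceeds 1. -/
theorem div_four_lt_log {n : ℕ} (h2 : 2 ≤ n) (h8 : n ≤ 8) : (n : ℝ) / 4 < Real.log n := by
  have hn : (0 : ℝ) < n := by exact_mod_cast (by omega : 0 < n)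
  rw [Real.lt_log_iff_exp_lt hn]
  have he : Real.exp 1 < 2.72 := Real.exp_one_lt_d9.trans (by norm_num)
  have h1 : Real.exp ((n : ℝ) / 4) ^ 4 = Real.exp 1 ^ n := by
    rw [← Real.exp_nat_mul, ← Real.exp_nat_mul]
    congr 1
    push_cast
    ring
  refine lt_of_pow_lt_pow_left₀ 4 hn.le ?_
  rw [h1]
  refine (pow_lt_pow_left₀ he (Real.exp_pos _).le (by omega)).trans ?_
  interval_cases n <;> norm_num

theorem two_lt_log_and_log_le {n : ℕ} (h9 : 9 ≤ n) :
    2 < Real.log n ∧ Real.log n ≤ (n : ℝ) / 4 := by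
  have hn9 : (9 : ℝ) ≤ n := by exact_mod_cast h9
  constructor
  · rw [Real.lt_log_iff_exp_lt (by linarith), show (2 : ℝ) = (2 : ℕ) * 1 by norm_num,
      Real.exp_nat_mul]
    have := pow_lt_pow_left₀ Real.exp_one_lt_d9 (Real.exp_pos _).le two_ne_zero
    refine this.trans (lt_of_lt_of_le (by norm_num) hn9)
  · have h1 : Real.log 9 ≤ 9 / 4 := by
      rw [Real.log_le_iff_le_exp (by norm_num)]
      refine le_of_pow_le_pow_left₀ (n := 4) (by norm_num) (Real.exp_pos _).le ?_
      rw [← Real.exp_nat_mul, show ((4 : ℕ) : ℝ) * (9 / 4) = (9 : ℕ) * 1 by norm_num,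
        Real.exp_nat_mul]
      have := pow_le_pow_left₀ (by norm_num) Real.exp_one_gt_d9.le 9
      exact le_trans (by norm_num) this
    have h2 : Real.log n = Real.log 9 + Real.log (n / 9) := by
      rw [Real.log_div (by linarith) (by norm_num)]; ring
    have h3 := Real.log_le_sub_one_of_pos (show (0 : ℝ) < n / 9 by linarith)
    linarith

/-- By convexity `exp` lies below its chord on `[2/3, 1]`, and `3x` dominates it at both endpoints.
-/
theorem exp_le_three_mul {x : ℝ} (h1 : 2 / 3 ≤ x) (h2 : x ≤ 1) : Real.exp x ≤ 3 * x := by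
  have he : Real.exp 1 < 2.72 := Real.exp_one_lt_d9.trans (by norm_num)
  have he23 : Real.exp (2 / 3) ≤ 2 := by
    refine le_of_pow_le_pow_left₀ (n := 3) (by norm_num) (by norm_num) ?_
    rw [← Real.exp_nat_mul, show ((3 : ℕ) : ℝ) * (2 / 3) = (2 : ℕ) * 1 by norm_num,
      Real.exp_nat_mul]
    have := pow_lt_pow_left₀ he (Real.exp_pos _).le two_ne_zero
    refine this.le.trans (by norm_num)
  have h := convexOn_exp.2 (Set.mem_univ (2 / 3)) (Set.mem_univ 1)
    (show 0 ≤ 3 * (1 - x) by linarith) (show 0 ≤ 3 * x - 2 by linarith) (by ring)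
  simp only [smul_eq_mul] at h
  rw [show 3 * (1 - x) * (2 / 3) + (3 * x - 2) * 1 = x by ring] at h
  nlinarith

theorem lt_four_mul_rpow_of_le_one {n : ℕ} (h2 : 2 ≤ n) (h8 : n ≤ 8) {e b : ℝ} (he : e ≤ 1)
    (hb : b ≤ 1) : b < 4 * (Real.log n / n) ^ e := by
  have hn : (0 : ℝ) < n := by exact_mod_cast (by omega : 0 < n)
  have h := div_four_lt_log h2 h8
  have h0 : 0 < Real.log n / n := div_pos (by linarith) hn
  have h1 : Real.log n / n ≤ 1 := by
    rw [div_le_one hn]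
    linarith [Real.log_le_sub_one_of_pos hn]
  have h3 := Real.rpow_le_rpow_of_exponent_ge h0 h1 he
  rw [Real.rpow_one] at h3
  have h4 : 1 / 4 < Real.log n / n := by
    rw [lt_div_iff₀ hn]; linarith
  linarith

/-- With `d = ⌈log n⌉` and `m = ⌊n / d⌋`, the `d`-th root of `d * m ≤ n` is at most `exp x` for `x =
log n / d`. Here `d ≥ 3` forces `x ≥ 2/3`, and `log n ≤ n / 4` keeps the rounding loss in `d * m >
3n/4` small. The constant 4 is the 3 of `exp x ≤ 3x` divided by this `3/4`. -/
theorem lt_four_mul_rpow_of_forall_pow_le {n : ℕ} (h9 : 9 ≤ n) {e b : ℝ} (he : e ≤ 1)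
    (hb : ∀ d m : ℕ, d ≠ 0 → m ≠ 0 → 5 ≤ d * m → d * m ≤ n → ((m : ℝ) ^ e * b) ^ d ≤ (d * m : ℕ)) :
    b < 4 * (Real.log n / n) ^ e := by
  have hn : (0 : ℝ) < n := by exact_mod_cast (by omega : 0 < n)
  obtain ⟨hL2, hL4⟩ := two_lt_log_and_log_le h9
  set L := Real.log n with hL
  set d := ⌈L⌉₊ with hd_def
  have hLd : L ≤ d := Nat.le_ceil L
  have hdL : (d : ℝ) < L + 1 := Nat.ceil_lt_add_one (by linarith)
  have hd3 : 3 ≤ d := by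
    have : (2 : ℝ) < d := by linarith
    exact_mod_cast this
  have hd3' : (3 : ℝ) ≤ d := by exact_mod_cast hd3
  have hd0 : (0 : ℝ) < d := by linarith
  set m := n / d with hm_def
  have hmn : d * m ≤ n := Nat.mul_div_le n d
  have hnm : n + 1 ≤ d * m + d := by
    have := Nat.lt_mul_div_succ n (show 0 < d by omega)
    rw [mul_add, mul_one] at this
    exact this
  have hmn' : (d : ℝ) * m ≤ n := by exact_mod_cast hmn
  have hnm' : (n : ℝ) + 1 ≤ d * m + d := by exact_mod_cast hnm
  have h34 : 3 / 4 * (n : ℝ) < d * m := by linarith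
  have hn9 : (9 : ℝ) ≤ n := by exact_mod_cast h9
  have h5 : 5 ≤ d * m := by
    have : (5 : ℝ) ≤ d * m := by linarith
    exact_mod_cast this
  have hm0 : m ≠ 0 := by
    intro h
    rw [h] at h5
    omega
  have hm0' : (0 : ℝ) < m := by positivity
  have key := hb d m (by omega) hm0 h5 hmn
  set x := L / d with hx
  have hx1 : x ≤ 1 := by rw [hx, div_le_one hd0]; exact hLd
  have hx23 : 2 / 3 ≤ x := by
    rw [hx, le_div_iff₀ hd0]
    linarith
  have hexp : (m : ℝ) ^ e * b ≤ Real.exp x := by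
    refine le_of_pow_le_pow_left₀ (n := d) (by omega) (Real.exp_pos _).le (key.trans ?_)
    rw [← Real.exp_nat_mul, hx, mul_div_cancel₀ _ hd0.ne', hL, Real.exp_log hn]
    exact_mod_cast hmn
  have hlt : Real.exp x < 4 * ((m : ℝ) * (L / n)) := by
    refine (exp_le_three_mul hx23 hx1).trans_lt ?_
    have : (m : ℝ) * (L / n) = x * (d * m / n) := by rw [hx]; field_simp
    rw [this]
    have h1 : 3 / 4 < (d : ℝ) * m / n := by rw [lt_div_iff₀ hn]; exact h34
    nlinarith
  have hy1 : (m : ℝ) * (L / n) ≤ 1 := by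
    have h1 : (m : ℝ) * L ≤ m * d := mul_le_mul_of_nonneg_left hLd hm0'.le
    rw [← mul_div_assoc, div_le_one hn]
    linarith
  -- Since `m * (L / n) ≤ 1` and `e ≤ 1`, raising to the power `e` only increases it, so the
  -- estimate with exponent 1 suffices for every `e ≤ 1`.
  have hy := Real.rpow_le_rpow_of_exponent_ge (show 0 < (m : ℝ) * (L / n) by positivity) hy1 he
  rw [Real.rpow_one, Real.mul_rpow hm0'.le (by positivity)] at hy
  have hme : 0 < (m : ℝ) ^ e := by positivity
  refine lt_of_mul_lt_mul_left (a := (m : ℝ) ^ e) ?_ hme.le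
  linarith

/-- Strict Bernoulli for `(1 - 1/3)^(1/n)`; strictness needs the exponent below 1, that is `n > 1`.
-/
theorem one_div_three_mul_lt {n : ℕ} (hn : 1 < n) :
    (1 / 3 : ℝ) * (1 / (n : ℝ)) < 1 - (2 / 3 : ℝ) ^ (1 / (n : ℝ)) := by
  have hn1 : (1 : ℝ) < n := by exact_mod_cast hn
  have h := rpow_one_add_lt_one_add_mul_self (s := -1 / 3) (by norm_num) (by norm_num)
    (p := 1 / (n : ℝ)) (by positivity) (by rw [div_lt_one (by linarith)]; exact hn1)
  rw [show (1 : ℝ) + -1 / 3 = 2 / 3 by norm_num] at h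
  linarith

theorem rpow_neg_div_three_mul_sqrt {n : ℕ} (hn : n ≠ 0) (q : ℝ) :
    (n : ℝ) ^ (-q) / (3 * √(n : ℝ)) = (1 / 3 : ℝ) * (1 / (n : ℝ)) ^ (1 / 2 + q : ℝ) := by
  have hn0 : (0 : ℝ) < n := by positivity
  rw [one_div (n : ℝ), Real.inv_rpow hn0.le, Real.rpow_add hn0, Real.rpow_neg hn0.le,
    ← Real.sqrt_eq_rpow]
  field_simp

/-! ### The main theorem -/

theorem mem_secondBohrSet_lt {n : ℕ} (hn : 1 < n) {p : ℝ≥0∞} (hp : 1 ≤ p) {h : ℝ} (h0 : 0 ≤ h)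
    (hh : p ≤ 2 ∧ h = 0 ∨ 2 ≤ p ∧ h = 1 / 2 - p⁻¹.toReal) {b : ℝ}
    (hb : b ∈ secondBohrSet (lpUnitBall n p)) : b < 4 * (Real.log n / n) ^ (1 - h) := by
  rcases le_or_gt n 8 with h8 | h8
  · exact lt_four_mul_rpow_of_le_one hn h8 (by linarith)
      (le_one_of_mem_secondBohrSet (by omega) hp hb)
  · refine lt_four_mul_rpow_of_forall_pow_le h8 (by linarith) fun d m hd hm h5 hdm => ?_
    obtain ⟨T, hT, hTN⟩ := exists_unimodular_norm_le h5
    exact pow_le_of_mem_secondBohrSet hp hd hm hdm hh hT (by exact_mod_cast (by omega)) hTN hb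

/-- The first conjunct says that the largest admissible `r` exists, so that `B(B_p^n)` is that
largest `r` and not just a supremum. For `p = ∞` the term `1/p`, written `p⁻¹.toReal`, is `0`. -/
theorem mainTheorem2 (n : ℕ) (hn : 1 < n) (p : ℝ≥0∞) (hp : 1 ≤ p) :
    IsGreatest (secondBohrSet (lpUnitBall n p)) (secondBohrRadius (lpUnitBall n p)) ∧
    (p ≤ 2 →
      (1 / 3 : ℝ) * (1 / (n : ℝ)) < 1 - (2 / 3 : ℝ) ^ (1 / (n : ℝ)) ∧
      1 - (2 / 3 : ℝ) ^ (1 / (n : ℝ)) ≤ secondBohrRadius (lpUnitBall n p) ∧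
      secondBohrRadius (lpUnitBall n p) < 4 * (Real.log n / n)) ∧
    (2 ≤ p →
      (1 / 3 : ℝ) * (1 / (n : ℝ)) ^ (1 / 2 + p⁻¹.toReal : ℝ)
        ≤ secondBohrRadius (lpUnitBall n p) ∧
      secondBohrRadius (lpUnitBall n p)
        < 4 * (Real.log n / n) ^ (1 / 2 + p⁻¹.toReal : ℝ)) := by
  have hn0 : n ≠ 0 := by omega
  have hbdd : BddAbove (secondBohrSet (lpUnitBall n p)) :=
    ⟨1, fun r hr => le_one_of_mem_secondBohrSet hn0 hp hr⟩
  have hmem : secondBohrRadius (lpUnitBall n p) ∈ secondBohrSet (lpUnitBall n p) :=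
    (isClosed_secondBohrSet fun z hz => norm_le_one_of_mem_lpUnitBall hp hz).csSup_mem
      ⟨0, zero_mem_secondBohrSet (zero_mem_lpUnitBall hp)⟩ hbdd
  refine ⟨⟨hmem, fun r hr => le_csSup hbdd hr⟩, fun hp2 => ⟨one_div_three_mul_lt hn, ?_, ?_⟩,
    fun hp2 => ⟨?_, ?_⟩⟩
  · exact le_csSup hbdd (one_sub_rpow_mem_secondBohrSet hn0 (zero_mem_lpUnitBall hp)
      fun z hz w hw => mul_mem_lpUnitBall hp hz hw)
  · simpa using mem_secondBohrSet_lt hn hp le_rfl (Or.inl ⟨hp2, rfl⟩) hmem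
  · rw [← rpow_neg_div_three_mul_sqrt hn0]
    exact le_csSup hbdd (div_mem_secondBohrSet hn0
      (fun z hz => norm_le_one_of_mem_lpUnitBall hp hz) (by positivity)
      fun z t ht hz => mem_lpUnitBall_of_norm_le hn0 hp ht hz)
  · have hq : p⁻¹.toReal ≤ 1 / 2 := by
      have := ENNReal.toReal_mono (by simp) (ENNReal.inv_le_inv.2 hp2)
      simpa using this
    have := mem_secondBohrSet_lt hn hp (sub_nonneg.2 hq) (Or.inr ⟨hp2, rfl⟩) hmem
    rwa [show 1 - (1 / 2 - p⁻¹.toReal) = 1 / 2 + p⁻¹.toReal by ring] at this
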